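/- Let $H$ be a $d$-dimensional complex Hilbert space ($d$ finite), and let $\rho,\sigma$ be density operators on $H$ (positive semidefinite, trace one) with the same spectrum, with spectral decompositions $$\rho=\sum_{i=1}^{m} r_i\sum_{k=1}^{n_i}|r_i^k\rangle\langle r_i^k|,\qquad \sigma=\sum_{i=1}^{m} r_i\sum_{k=1}^{n_i}|s_i^k\rangle\langle s_i^k|,$$ where the eigenvalues $r_1,\dots,r_m$ are pairwise distinct, $n_i\ge 1$, $\sum_{i=1}^m n_i=d$, and $\{|r_i^k\rangle\}_{i,k}$ and $\{|s_i^k\rangle\}_{i,k}$ are orthonormal bases of $H$. Let $$\rho_i=\frac1{n_i}\sum_{k=1}^{n_i}|r_i^k\rangle\langle r_i^k|,\qquad \sigma_i=\frac1{n_i}\sum_{k=1}^{n_i}|s_i^k\rangle\langle s_i^k|$$ be the maximally mixed states on the corresponding eigenspaces. For density operators $\alpha,\beta$ let $\theta_B(\alpha,\beta)=\arccos\mathcal F(\alpha,\beta)$ be the Bures angle, where $\mathcal F(\alpha,\beta)=\operatorname{tr}\sqrt{\sqrt{\alpha}\,\beta\sqrt{\alpha}}$. Let the quantum charging distance $D(\rho,\sigma)$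 be the minimal (infimal) time $T\ge 0$ for which there is a measurable, possibly time-dependent, self-adjoint Hamiltonian $V_t$, $t\in[0,T]$, of operator norm $\|V_t\|=1$ such that $\sigma=U\rho U^\dagger$ with $U=\mathrm{Texp}\left(-i\int_0^T V_t\,dt\right)$, that is, $U=U_T$ where $U_t=1-i\int_0^t V_sU_s\,ds$ for $t\in[0,T]$. Then $$\max_{1\le i\le m}\theta_B(\rho_i,\sigma_i)\le D(\rho,\sigma).$$ -/

import Mathlib

open MeasureTheory InnerProductSpace

noncomputable section

namespace QuantumCharging

variable {H : Type*} [NormedAddCommGroup H] [InnerProductSpace ℂ H]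

/-- The trace of an operator on a finite-dimensional Hilbert space. -/
def opTrace (A : H →L[ℂ] H) : ℂ :=
  LinearMap.trace ℂ H (A : H →ₗ[ℂ] H)

/-- Density operators: positive semidefinite (Loewner order) with unit trace. -/
structure IsDensityOperator (ρ : H →L[ℂ] H) : Prop where
  nonneg : 0 ≤ ρ
  trace_eq_one : opTrace ρ = 1

/-- The operator `∑ i, r i ∑ k, |b i k⟩⟨b i k|`; when `b` is an orthonormal basis, it has
eigenvalue `r i` on the span of the vectors `b i k`. -/
def spectralOperator {m : ℕ} {n : Fin m → ℕ} (r : Fin m → ℝ)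
    (b : (Σ i : Fin m, Fin (n i)) → H) : H →L[ℂ] H :=
  ∑ i, (r i : ℂ) • ∑ k : Fin (n i), rankOne ℂ (b ⟨i, k⟩) (b ⟨i, k⟩)

/-- The maximally mixed state `(1 / N) ∑ k, |e k⟩⟨e k|` on the span of an orthonormal family. -/
def maximallyMixed {N : ℕ} (e : Fin N → H) : H →L[ℂ] H :=
  (N : ℂ)⁻¹ • ∑ k, rankOne ℂ (e k) (e k)

variable [CompleteSpace H]

/-- Uhlmann's fidelity `tr √(√ρ σ √ρ)`; the trace is that of a positive operator, hence real. -/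
def fidelity (ρ σ : H →L[ℂ] H) : ℝ :=
  (opTrace (CFC.sqrt (CFC.sqrt ρ * σ * CFC.sqrt ρ))).re

/-- The Bures angle. -/
def buresAngle (ρ σ : H →L[ℂ] H) : ℝ :=
  Real.arccos (fidelity ρ σ)

/-- A (possibly time-dependent) charging Hamiltonian on `[0, T]`: a measurable family of
self-adjoint operators of operator norm one. -/
structure IsChargingHamiltonian (T : ℝ) (V : ℝ → H →L[ℂ] H) : Prop where
  aestronglyMeasurable : AEStronglyMeasurable V (volume.restrict (Set.Icc 0 T))
  selfAdjoint : ∀ t ∈ Set.Icc 0 T, IsSelfAdjoint (V t)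
  norm_eq_one : ∀ t ∈ Set.Icc 0 T, ‖V t‖ = 1

/-- `U t = Texp (-i ∫₀ᵗ V s ds)` for `t ∈ [0, T]`: the time-ordered exponential is the solution of
the Schrödinger equation `dU/dt = -i V U`, `U 0 = 1`, in integral form
(so that `V` may have jumps). -/
structure IsTimeOrderedExp (T : ℝ) (V U : ℝ → H →L[ℂ] H) : Prop where
  continuousOn : ContinuousOn U (Set.Icc 0 T)
  integral_eq : ∀ t ∈ Set.Icc 0 T, U t = 1 - Complex.I • ∫ s in (0 : ℝ)..t, V s * U s

/-- The times `T` in which some charging Hamiltonian drives `ρ` to `σ`. -/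
def chargingTimes (ρ σ : H →L[ℂ] H) : Set ℝ :=
  {T | 0 ≤ T ∧ ∃ V U : ℝ → H →L[ℂ] H, IsChargingHamiltonian T V ∧ IsTimeOrderedExp T V U ∧
    σ = U T * ρ * star (U T)}

/-- The quantum charging distance: the least time in which a charging Hamiltonian drives
`ρ` to `σ`. -/
def chargingDistance (ρ σ : H →L[ℂ] H) : ℝ :=
  sInf (chargingTimes ρ σ)

end QuantumCharging

end

/-!
A charging Hamiltonian of norm one moves a unit vector along a curve of speed at most one on the
unit sphere, so after time `T ≤ π` every unit vector `x` satisfies `cos T ≤ re ⟪x, U x⟫`. Since `U`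
intertwines `ρ` and `σ` and the eigenvalues are distinct, `U` also intertwines the eigenprojections
`P i` and `Q i`. By the variational bound `re tr (W X) ≤ tr |X|` for contractions `W`, the fidelity
of `P i / n i` and `Q i / n i` is at least `re tr (U† Q i P i) / n i`, which is the average of
`re ⟪x, U x⟫` over an orthonormal basis of the range of `P i`, and hence at least `cos T`.
-/

namespace QuantumCharging

section Angle

open InnerProductGeometry

variable {E : Type*} [NormedAddCommGroup E] [InnerProductSpace ℝ E]

theorem norm_sub_eq_two_mul_sin_half_angle {u v : E} (hu : ‖u‖ = 1) (hv : ‖v‖ = 1) :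
    ‖u - v‖ = 2 * Real.sin (angle u v / 2) := by
  have hsin : 0 ≤ Real.sin (angle u v / 2) :=
    Real.sin_nonneg_of_nonneg_of_le_pi (by linarith [angle_nonneg u v])
      (by linarith [angle_le_pi u v, Real.pi_pos])
  refine (pow_left_inj₀ (norm_nonneg _) (by positivity) two_ne_zero).1 ?_
  calc ‖u - v‖ ^ 2 = 2 - 2 * Real.cos (angle u v) := by
        rw [norm_sub_sq_real, hu, hv, cos_angle, hu, hv]; ring
    _ = (2 * Real.sin (angle u v / 2)) ^ 2 := by
        rw [mul_pow, Real.sin_sq_eq_half_sub, mul_div_cancel₀ _ two_ne_zero]; ring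

theorem angle_eq_two_mul_arcsin {u v : E} (hu : ‖u‖ = 1) (hv : ‖v‖ = 1) :
    angle u v = 2 * Real.arcsin (‖u - v‖ / 2) := by
  rw [norm_sub_eq_two_mul_sin_half_angle hu hv, mul_div_cancel_left₀ _ two_ne_zero,
    Real.arcsin_sin (by linarith [angle_nonneg u v, Real.pi_pos]) (by linarith [angle_le_pi u v]),
    mul_div_cancel₀ _ two_ne_zero]

theorem angle_le_sum_angle (f : ℕ → E) (N : ℕ) (hf : f 0 ≠ 0) :
    angle (f 0) (f N) ≤ ∑ j ∈ Finset.range N, angle (f j) (f (j + 1)) := by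
  induction N with
  | zero => simp [angle_self hf]
  | succ N ih =>
    rw [Finset.sum_range_succ]
    exact (angle_le_angle_add_angle _ (f N) _).trans (by gcongr)

theorem tendsto_mul_two_mul_arcsin_div (c : ℝ) :
    Filter.Tendsto (fun N : ℕ => (N : ℝ) * (2 * Real.arcsin (c / N / 2))) Filter.atTop
      (nhds c) := by
  have harg : HasDerivAt (fun s : ℝ => c * s / 2) (c / 2) 0 := by
    simpa using ((hasDerivAt_id (0 : ℝ)).const_mul c).div_const 2
  have harcsin : HasDerivAt Real.arcsin 1 (c * 0 / 2) := by
    simpa using Real.hasDerivAt_arcsin (x := 0) (by norm_num) (by norm_num)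
  have hderiv : HasDerivAt (fun s : ℝ => 2 * Real.arcsin (c * s / 2)) c 0 := by
    convert! (harcsin.comp (0 : ℝ) harg).const_mul 2 using 1
    ring
  refine (hderiv.tendsto_slope_zero_right.comp
    (tendsto_inv_atTop_nhdsGT_zero.comp tendsto_natCast_atTop_atTop)).congr fun N => ?_
  simp [div_eq_mul_inv]

theorem angle_le_of_lipschitzOnWith {ψ : ℝ → E} {a b : ℝ} {K : NNReal} (hab : a ≤ b)
    (hψ : LipschitzOnWith K ψ (Set.Icc a b)) (hnorm : ∀ t ∈ Set.Icc a b, ‖ψ t‖ = 1) :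
    angle (ψ a) (ψ b) ≤ K * (b - a) := by
  -- Inscribe a polygon with `N` vertices in the curve: its angular length is at most
  -- `N * (2 * arcsin (K * (b - a) / (2 * N)))`, which tends to `K * (b - a)`.
  refine ge_of_tendsto (tendsto_mul_two_mul_arcsin_div _) ?_
  filter_upwards [Filter.eventually_gt_atTop 0] with N hN
  let s : ℕ → ℝ := fun j => a + (b - a) / N * j
  have : 0 ≤ b - a := sub_nonneg.2 hab
  have hs_zero : s 0 = a := by simp [s]
  have hs_last : s N = b := by simp only [s]; field_simp; ring
  have hs_mem : ∀ j ≤ N, s j ∈ Set.Icc a b := fun j hj => by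
    refine ⟨le_add_of_nonneg_right (by positivity), hs_last ▸ ?_⟩
    simp only [s]
    gcongr
  have hstep : ∀ j < N, ‖ψ (s j) - ψ (s (j + 1))‖ ≤ K * (b - a) / N := fun j hj => by
    refine (hψ.norm_sub_le (hs_mem j hj.le) (hs_mem (j + 1) hj)).trans_eq ?_
    have hdiff : s j - s (j + 1) = -((b - a) / N) := by simp only [s]; push_cast; ring
    rw [hdiff, norm_neg, Real.norm_of_nonneg (by positivity), mul_div_assoc]
  have hne : ψ (s 0) ≠ 0 := norm_ne_zero_iff.1 (by simp [hnorm _ (hs_mem 0 N.zero_le)])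
  calc angle (ψ a) (ψ b) = angle (ψ (s 0)) (ψ (s N)) := by rw [hs_zero, hs_last]
    _ ≤ ∑ j ∈ Finset.range N, angle (ψ (s j)) (ψ (s (j + 1))) :=
        angle_le_sum_angle (fun j => ψ (s j)) N hne
    _ ≤ ∑ _j ∈ Finset.range N, 2 * Real.arcsin (K * (b - a) / N / 2) := by
        refine Finset.sum_le_sum fun j hj => ?_
        have hj := Finset.mem_range.1 hj
        rw [angle_eq_two_mul_arcsin (hnorm _ (hs_mem j hj.le)) (hnorm _ (hs_mem (j + 1) hj))]
        gcongr
        exact hstep j hj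
    _ = N * (2 * Real.arcsin (K * (b - a) / N / 2)) := by simp

end Angle

section Dynamics

variable {H : Type*} [NormedAddCommGroup H] [InnerProductSpace ℂ H]

theorem re_inner_neg_I_smul_apply_self [CompleteSpace H] {A : H →L[ℂ] H} (hA : IsSelfAdjoint A)
    (x : H) : (⟪x, -Complex.I • A x⟫_ℂ).re = 0 := by
  have him : (⟪x, A x⟫_ℂ).im = 0 := hA.isSymmetric.im_inner_self_apply x
  simp [inner_smul_right, him]

variable {T : ℝ} {V U : ℝ → H →L[ℂ] H}

namespace IsTimeOrderedExp

theorem apply_zero (hT : 0 ≤ T) (hU : IsTimeOrderedExp T V U) : U 0 = 1 := by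
  simpa using hU.integral_eq 0 ⟨le_rfl, hT⟩

variable [CompleteSpace H]

theorem integrableOn_mul (hU : IsTimeOrderedExp T V U) (hV : IsChargingHamiltonian T V) :
    IntegrableOn (fun t => V t * U t) (Set.Icc 0 T) := by
  obtain ⟨C, hC⟩ := isCompact_Icc.exists_bound_of_continuousOn hU.continuousOn
  refine Integrable.of_bound (C := C)
    (hV.aestronglyMeasurable.mul (hU.continuousOn.aestronglyMeasurable measurableSet_Icc)) ?_
  filter_upwards [ae_restrict_mem measurableSet_Icc] with t ht
  calc ‖V t * U t‖ ≤ ‖V t‖ * ‖U t‖ := norm_mul_le _ _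
    _ = ‖U t‖ := by rw [hV.norm_eq_one t ht, one_mul]
    _ ≤ C := hC t ht

theorem intervalIntegrable_mul (hU : IsTimeOrderedExp T V U) (hV : IsChargingHamiltonian T V)
    {s t : ℝ} (hs : s ∈ Set.Icc 0 T) (ht : t ∈ Set.Icc 0 T) :
    IntervalIntegrable (fun u => V u * U u) volume s t :=
  ((hU.integrableOn_mul hV).mono_set (Set.uIcc_subset_Icc hs ht)).intervalIntegrable

theorem sub_eq_integral (hU : IsTimeOrderedExp T V U) (hV : IsChargingHamiltonian T V)
    {s t : ℝ} (hs : s ∈ Set.Icc 0 T) (ht : t ∈ Set.Icc 0 T) :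
    U t - U s = -Complex.I • ∫ u in s..t, V u * U u := by
  have h0 : (0 : ℝ) ∈ Set.Icc 0 T := ⟨le_rfl, hs.1.trans hs.2⟩
  rw [hU.integral_eq t ht, hU.integral_eq s hs, ← intervalIntegral.integral_interval_sub_left
    (hU.intervalIntegrable_mul hV h0 ht) (hU.intervalIntegrable_mul hV h0 hs)]
  module

theorem lipschitzOnWith (hU : IsTimeOrderedExp T V U) (hV : IsChargingHamiltonian T V)
    {M : NNReal} (hM : ∀ t ∈ Set.Icc 0 T, ‖U t‖ ≤ M) : LipschitzOnWith M U (Set.Icc 0 T) := by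
  refine LipschitzOnWith.of_dist_le_mul fun t ht s hs => ?_
  rw [dist_eq_norm, hU.sub_eq_integral hV hs ht, norm_smul, norm_neg, Complex.norm_I, one_mul,
    Real.dist_eq]
  refine intervalIntegral.norm_integral_le_of_norm_le_const fun u hu => ?_
  have hu : u ∈ Set.Icc 0 T := Set.uIcc_subset_Icc hs ht (Set.uIoc_subset_uIcc hu)
  calc ‖V u * U u‖ ≤ ‖V u‖ * ‖U u‖ := norm_mul_le _ _
    _ = ‖U u‖ := by rw [hV.norm_eq_one u hu, one_mul]
    _ ≤ M := hM u hu

theorem ae_hasDerivAt (hT : 0 ≤ T) (hU : IsTimeOrderedExp T V U)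
    (hV : IsChargingHamiltonian T V) :
    ∀ᵐ t, t ∈ Set.Ioo 0 T → HasDerivAt U (-Complex.I • (V t * U t)) t := by
  have h0 : (0 : ℝ) ∈ Set.Icc 0 T := ⟨le_rfl, hT⟩
  filter_upwards [(hU.intervalIntegrable_mul hV h0 ⟨hT, le_rfl⟩).ae_hasDerivAt_integral]
    with t hderiv ht
  rw [Set.uIcc_of_le hT] at hderiv
  refine (((hderiv (Set.Ioo_subset_Icc_self ht) 0 h0).fun_const_smul (-Complex.I)).const_add
    1).congr_of_eventuallyEq ?_
  filter_upwards [isOpen_Ioo.mem_nhds ht] with s hs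
  rw [hU.integral_eq s (Set.Ioo_subset_Icc_self hs), neg_smul, sub_eq_add_neg]

theorem lipschitzOnWith_apply (hU : IsTimeOrderedExp T V U) (hV : IsChargingHamiltonian T V)
    {M : NNReal} (hM : ∀ t ∈ Set.Icc 0 T, ‖U t‖ ≤ M) (x : H) :
    LipschitzOnWith (M * ‖x‖₊) (fun t => U t x) (Set.Icc 0 T) := by
  refine LipschitzOnWith.of_dist_le_mul fun t ht s hs => ?_
  calc dist (U t x) (U s x) = ‖(U t - U s) x‖ := by rw [dist_eq_norm, sub_apply]
    _ ≤ M * ‖t - s‖ * ‖x‖ :=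
        (U t - U s).le_of_opNorm_le ((hU.lipschitzOnWith hV hM).norm_sub_le ht hs) x
    _ = ↑(M * ‖x‖₊) * dist t s := by rw [dist_eq_norm]; push_cast; ring

theorem norm_apply (hU : IsTimeOrderedExp T V U) (hV : IsChargingHamiltonian T V)
    {t : ℝ} (ht : t ∈ Set.Icc 0 T) (x : H) : ‖U t x‖ = ‖x‖ := by
  -- `U` is differentiable only almost everywhere, so constancy of `‖U t x‖ ^ 2` also needs its
  -- absolute continuity.
  let : InnerProductSpace ℝ H := InnerProductSpace.rclikeToReal ℂ H
  have hT : 0 ≤ T := ht.1.trans ht.2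
  have hIcc : Set.uIcc 0 T = Set.Icc 0 T := Set.uIcc_of_le hT
  obtain ⟨M, hM⟩ := isCompact_Icc.exists_bound_of_continuousOn hU.continuousOn
  lift M to NNReal using (norm_nonneg _).trans (hM t ht)
  have hnorm : AbsolutelyContinuousOnInterval (fun s => ‖U s x‖) 0 T :=
    (lipschitzWith_one_norm.comp_lipschitzOnWith
      ((hU.lipschitzOnWith_apply hV hM x).mono hIcc.subset)).absolutelyContinuousOnInterval
  have hderiv : ∀ᵐ s, s ∈ Set.uIcc 0 T → HasDerivAt (fun s => ‖U s x‖ * ‖U s x‖) 0 s := by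
    filter_upwards [hU.ae_hasDerivAt hT hV, Measure.ae_ne volume 0, Measure.ae_ne volume T]
      with s hs hs0 hsT hmem
    rw [hIcc] at hmem
    have hUs := hs ⟨hmem.1.lt_of_ne' hs0, hmem.2.lt_of_ne hsT⟩
    have hUx : HasDerivAt (fun s => U s x) (-Complex.I • V s (U s x)) s :=
      ((ContinuousLinearMap.apply ℂ H x).restrictScalars ℝ).hasFDerivAt.comp_hasDerivAt s hUs
    simp only [← pow_two]
    convert! hUx.norm_sq using 1
    exact (mul_eq_zero_of_right 2
      (re_inner_neg_I_smul_apply_self (hV.selfAdjoint s hmem) (U s x))).symm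
  obtain ⟨C, hC⟩ := (hnorm.mul hnorm).const_of_ae_hasDerivAt_zero hderiv
  have hsq : ‖U t x‖ * ‖U t x‖ = ‖U 0 x‖ * ‖U 0 x‖ :=
    (hC t (hIcc ▸ ht)).trans (hC 0 Set.left_mem_uIcc).symm
  rw [hU.apply_zero hT] at hsq
  exact (mul_self_inj (norm_nonneg _) (norm_nonneg _)).1 hsq

theorem star_mul_self (hU : IsTimeOrderedExp T V U) (hV : IsChargingHamiltonian T V)
    {t : ℝ} (ht : t ∈ Set.Icc 0 T) : star (U t) * U t = 1 :=
  (U t).norm_map_iff_adjoint_comp_self.1 (hU.norm_apply hV ht)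

theorem norm_le_one (hU : IsTimeOrderedExp T V U) (hV : IsChargingHamiltonian T V)
    {t : ℝ} (ht : t ∈ Set.Icc 0 T) : ‖U t‖ ≤ 1 :=
  (U t).opNorm_le_bound zero_le_one fun x => by rw [hU.norm_apply hV ht, one_mul]

theorem cos_le_re_inner (hT : 0 ≤ T) (hTπ : T ≤ Real.pi) (hU : IsTimeOrderedExp T V U)
    (hV : IsChargingHamiltonian T V) {x : H} (hx : ‖x‖ = 1) :
    Real.cos T ≤ (⟪x, U T x⟫_ℂ).re := by
  let : InnerProductSpace ℝ H := InnerProductSpace.rclikeToReal ℂ H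
  have hnorm : ∀ t ∈ Set.Icc 0 T, ‖U t x‖ = 1 := fun t ht => (hU.norm_apply hV ht x).trans hx
  have hlip := hU.lipschitzOnWith_apply hV (M := 1) (fun t ht => hU.norm_le_one hV ht) x
  have hangle : InnerProductGeometry.angle x (U T x) ≤ T := by
    simpa [hU.apply_zero hT, hx] using angle_le_of_lipschitzOnWith hT hlip hnorm
  calc Real.cos T ≤ Real.cos (InnerProductGeometry.angle x (U T x)) :=
        Real.cos_le_cos_of_nonneg_of_le_pi (InnerProductGeometry.angle_nonneg _ _) hTπ hangle
    _ = (⟪x, U T x⟫_ℂ).re := by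
        rw [InnerProductGeometry.cos_angle, hx, hnorm T ⟨hT, le_rfl⟩, mul_one, div_one]
        rfl

end IsTimeOrderedExp

end Dynamics

section Projections

theorem mul_eq_mul_of_sum_smul_mul_eq {K A ι : Type*} [Field K] [Ring A] [Algebra K A] [Fintype ι]
    {p q : ι → A} (hp : CompleteOrthogonalIdempotents p) (hq : CompleteOrthogonalIdempotents q)
    {c : ι → K} (hc : Function.Injective c) {u : A}
    (h : (∑ i, c i • q i) * u = u * ∑ i, c i • p i) (i : ι) : q i * u = u * p i := by
  classical
  have hleft : ∀ j, q j * ∑ i, c i • q i = c j • q j := fun j => by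
    simp [Finset.mul_sum, hq.mul_eq]
  have hright : ∀ i, (∑ j, c j • p j) * p i = c i • p i := fun i => by
    simp [Finset.sum_mul, hp.mul_eq]
  have hoff : ∀ j k, j ≠ k → q j * u * p k = 0 := fun j k hjk => by
    have hsmul : c j • (q j * u * p k) = c k • (q j * u * p k) := by
      calc c j • (q j * u * p k) = q j * ((∑ i, c i • q i) * u) * p k := by
            rw [← mul_assoc, hleft, smul_mul_assoc, smul_mul_assoc]
        _ = c k • (q j * u * p k) := by
            rw [h, ← mul_assoc, mul_assoc, hright, mul_smul_comm]
    rw [← sub_eq_zero, ← sub_smul] at hsmul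
    exact (smul_eq_zero.1 hsmul).resolve_left (sub_ne_zero.2 (hc.ne hjk))
  calc q i * u = q i * u * ∑ k, p k := by rw [hp.complete, mul_one]
    _ = q i * u * p i := by
        rw [Finset.mul_sum, Fintype.sum_eq_single i fun k hk => hoff i k hk.symm]
    _ = (∑ j, q j) * u * p i := by
        rw [Finset.sum_mul, Finset.sum_mul, Fintype.sum_eq_single i fun j hj => hoff j i hj]
    _ = u * p i := by rw [hq.complete, one_mul]

variable {H : Type*} [NormedAddCommGroup H] [InnerProductSpace ℂ H]
variable {ι κ : Type*} [Fintype ι] [Fintype κ]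

/-- The frame operator `∑ k, |e k⟩⟨e k|` of a finite family `e`. For an orthonormal family it is
the orthogonal projection onto the span of `e`. -/
noncomputable def frameOperator (e : ι → H) : H →L[ℂ] H :=
  ∑ k, rankOne ℂ (e k) (e k)

theorem spectralOperator_eq_sum_smul_frameOperator {m : ℕ} {n : Fin m → ℕ} (r : Fin m → ℝ)
    (e : (Σ i : Fin m, Fin (n i)) → H) :
    spectralOperator r e = ∑ i, (r i : ℂ) • frameOperator fun k : Fin (n i) => e ⟨i, k⟩ :=
  rfl

theorem maximallyMixed_eq_smul_frameOperator {N : ℕ} (e : Fin N → H) :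
    maximallyMixed e = (N : ℝ)⁻¹ • frameOperator e := by
  rw [← Complex.coe_smul]
  simp [maximallyMixed, frameOperator]

theorem frameOperator_apply (e : ι → H) (x : H) :
    frameOperator e x = ∑ k, ⟪e k, x⟫_ℂ • e k := by
  simp [frameOperator]

theorem frameOperator_apply_self {e : ι → H} (he : Orthonormal ℂ e) (k : ι) :
    frameOperator e (e k) = e k := by
  classical
  simp [frameOperator_apply, orthonormal_iff_ite.1 he]

theorem mul_frameOperator_eq_sum (A : H →L[ℂ] H) (e : ι → H) :
    A * frameOperator e = ∑ k, rankOne ℂ (A (e k)) (e k) := by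
  rw [frameOperator, Finset.mul_sum]
  exact Finset.sum_congr rfl fun k _ => comp_rankOne _ _ _

theorem isIdempotentElem_frameOperator {e : ι → H} (he : Orthonormal ℂ e) :
    IsIdempotentElem (frameOperator e) := by
  simp only [IsIdempotentElem, mul_frameOperator_eq_sum, frameOperator_apply_self he]
  rfl

theorem frameOperator_mul_frameOperator_eq_zero {e : ι → H} {f : κ → H}
    (h : ∀ j k, ⟪e j, f k⟫_ℂ = 0) : frameOperator e * frameOperator f = 0 := by
  simp [mul_frameOperator_eq_sum, frameOperator_apply, h]

theorem completeOrthogonalIdempotents_frameOperator {ν : ι → Type*} [∀ i, Fintype (ν i)]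
    (b : OrthonormalBasis (Σ i, ν i) ℂ H) :
    CompleteOrthogonalIdempotents fun i => frameOperator fun k : ν i => b ⟨i, k⟩ where
  idem i := isIdempotentElem_frameOperator (b.orthonormal.comp _ sigma_mk_injective)
  ortho i j hij := frameOperator_mul_frameOperator_eq_zero fun k l =>
    b.orthonormal.inner_eq_zero fun h => hij (congrArg Sigma.fst h)
  complete := by
    simp only [frameOperator]
    rw [← Fintype.sum_sigma fun x => rankOne ℂ (b x) (b x)]
    exact b.sum_rankOne_eq_id

theorem opTrace_mul_frameOperator [FiniteDimensional ℂ H] (A : H →L[ℂ] H) (e : ι → H) :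
    opTrace (A * frameOperator e) = ∑ k, ⟪e k, A (e k)⟫_ℂ := by
  simp [mul_frameOperator_eq_sum, opTrace, trace_rankOne]

theorem re_opTrace_smul (c : ℝ) (A : H →L[ℂ] H) : (opTrace (c • A)).re = c * (opTrace A).re := by
  rw [← Complex.coe_smul, opTrace, ContinuousLinearMap.toLinearMap_smul, map_smul, smul_eq_mul,
    Complex.re_ofReal_mul, opTrace]

variable [CompleteSpace H]

theorem frameOperator_nonneg (e : ι → H) : 0 ≤ frameOperator e :=
  Finset.sum_nonneg fun k _ =>
    (ContinuousLinearMap.nonneg_iff_isPositive _).2 (isPositive_rankOne_self (e k))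

theorem frameOperator_apply_comp (A : H →L[ℂ] H) (e : ι → H) :
    frameOperator (fun k => A (e k)) = A * frameOperator e * star A := by
  rw [mul_frameOperator_eq_sum, Finset.sum_mul, frameOperator]
  refine Finset.sum_congr rfl fun k _ => ?_
  rw [ContinuousLinearMap.mul_def, rankOne_comp, ← ContinuousLinearMap.star_eq_adjoint, star_star]

theorem spectralOperator_apply_comp {m : ℕ} {n : Fin m → ℕ} (r : Fin m → ℝ) (A : H →L[ℂ] H)
    (e : (Σ i : Fin m, Fin (n i)) → H) :
    spectralOperator r (fun j => A (e j)) = A * spectralOperator r e * star A := by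
  simp only [spectralOperator_eq_sum_smul_frameOperator, frameOperator_apply_comp, Finset.mul_sum,
    Finset.sum_mul, mul_smul_comm, smul_mul_assoc]

end Projections

section Fidelity

variable {H : Type*} [NormedAddCommGroup H] [InnerProductSpace ℂ H] [CompleteSpace H]

theorem norm_abs_apply (X : H →L[ℂ] H) (x : H) : ‖CFC.abs X x‖ = ‖X x‖ := by
  have habs : star (CFC.abs X) * CFC.abs X = star X * X := by
    rw [(CFC.abs_nonneg X).isSelfAdjoint.star_eq, CFC.abs_mul_abs]
  have happly : ∀ A : H →L[ℂ] H, ‖A x‖ ^ 2 = RCLike.re ⟪x, (star A * A) x⟫_ℂ :=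
    fun A => A.apply_norm_sq_eq_inner_adjoint_right x
  refine (pow_left_inj₀ (norm_nonneg _) (norm_nonneg _) two_ne_zero).1 ?_
  rw [happly, happly, habs]

theorem re_inner_mul_le_of_abs_apply_eq_smul {W X : H →L[ℂ] H} (hW : ‖W‖ ≤ 1) {x : H} {c : ℝ}
    (hx : CFC.abs X x = (c : ℂ) • x) (hc : 0 ≤ c) :
    (⟪x, (W * X) x⟫_ℂ).re ≤ (⟪x, CFC.abs X x⟫_ℂ).re := by
  calc (⟪x, (W * X) x⟫_ℂ).re ≤ ‖x‖ * ‖W (X x)‖ :=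
        (Complex.re_le_norm _).trans (norm_inner_le_norm _ _)
    _ ≤ ‖x‖ * (1 * ‖X x‖) := by gcongr; exact W.le_of_opNorm_le hW _
    _ = ‖x‖ * (c * ‖x‖) := by
        rw [one_mul, ← norm_abs_apply, hx, norm_smul, Complex.norm_of_nonneg hc]
    _ = (⟪x, CFC.abs X x⟫_ℂ).re := by
        rw [hx, inner_smul_right, Complex.re_ofReal_mul, ← RCLike.re_eq_complex_re,
          inner_self_eq_norm_sq]
        ring

theorem re_opTrace_mul_le_re_opTrace_abs [FiniteDimensional ℂ H] {W : H →L[ℂ] H} (hW : ‖W‖ ≤ 1)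
    (X : H →L[ℂ] H) : (opTrace (W * X)).re ≤ (opTrace (CFC.abs X)).re := by
  have hpos : (CFC.abs X).IsPositive :=
    (ContinuousLinearMap.nonneg_iff_isPositive _).1 (CFC.abs_nonneg X)
  let e := hpos.isSymmetric.eigenvectorBasis rfl
  rw [opTrace, opTrace, LinearMap.trace_eq_sum_inner _ e, LinearMap.trace_eq_sum_inner _ e,
    Complex.re_sum, Complex.re_sum]
  exact Finset.sum_le_sum fun i _ => re_inner_mul_le_of_abs_apply_eq_smul hW
    (hpos.isSymmetric.apply_eigenvectorBasis rfl i) (hpos.toLinearMap.nonneg_eigenvalues rfl i)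

theorem fidelity_eq_re_opTrace_abs {σ : H →L[ℂ] H} (hσ : 0 ≤ σ) (ρ : H →L[ℂ] H) :
    fidelity ρ σ = (opTrace (CFC.abs (CFC.sqrt σ * CFC.sqrt ρ))).re := by
  have hstar : ∀ A : H →L[ℂ] H, star (CFC.sqrt A) = CFC.sqrt A := fun A =>
    (CFC.sqrt_nonneg A).isSelfAdjoint.star_eq
  have hsq : CFC.sqrt ρ * σ * CFC.sqrt ρ =
      star (CFC.sqrt σ * CFC.sqrt ρ) * (CFC.sqrt σ * CFC.sqrt ρ) := by
    rw [star_mul, hstar, hstar]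
    conv_lhs => rw [← CFC.sqrt_mul_sqrt_self σ hσ]
    simp only [mul_assoc]
  rw [fidelity, hsq, CFC.abs]

theorem re_opTrace_mul_sqrt_mul_sqrt_le_fidelity [FiniteDimensional ℂ H] {W σ : H →L[ℂ] H}
    (hW : ‖W‖ ≤ 1) (hσ : 0 ≤ σ) (ρ : H →L[ℂ] H) :
    (opTrace (W * (CFC.sqrt σ * CFC.sqrt ρ))).re ≤ fidelity ρ σ :=
  (re_opTrace_mul_le_re_opTrace_abs hW _).trans_eq (fidelity_eq_re_opTrace_abs hσ ρ).symm

theorem maximallyMixed_nonneg {N : ℕ} (e : Fin N → H) : 0 ≤ maximallyMixed e := by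
  rw [maximallyMixed_eq_smul_frameOperator]
  exact smul_nonneg (by positivity) (frameOperator_nonneg e)

theorem sqrt_maximallyMixed {N : ℕ} {e : Fin N → H} (he : Orthonormal ℂ e) :
    CFC.sqrt (maximallyMixed e) = ((√N)⁻¹ : ℝ) • frameOperator e := by
  refine CFC.sqrt_unique ?_ (smul_nonneg (by positivity) (frameOperator_nonneg e))
  rw [smul_mul_smul_comm, (isIdempotentElem_frameOperator he).eq, ← mul_inv,
    Real.mul_self_sqrt (by positivity), maximallyMixed_eq_smul_frameOperator]

theorem inv_mul_sum_re_inner_le_fidelity [FiniteDimensional ℂ H] {N : ℕ} {e f : Fin N → H}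
    (he : Orthonormal ℂ e) (hf : Orthonormal ℂ f) {U : H →L[ℂ] H} (hU : ‖U‖ ≤ 1)
    (hcomm : frameOperator f * U = U * frameOperator e) :
    (N : ℝ)⁻¹ * ∑ k, (⟪e k, U (e k)⟫_ℂ).re ≤
      fidelity (maximallyMixed e) (maximallyMixed f) := by
  have hadj : star (star U * frameOperator f) = U * frameOperator e := by
    rw [star_mul, star_star, (frameOperator_nonneg f).isSelfAdjoint.star_eq, hcomm]
  have hterm : ∀ k, (⟪e k, (star U * frameOperator f) (e k)⟫_ℂ).re = (⟪e k, U (e k)⟫_ℂ).re :=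
    fun k => by
      rw [← ContinuousLinearMap.adjoint_inner_left, ← ContinuousLinearMap.star_eq_adjoint, hadj,
        mul_apply_eq_comp, frameOperator_apply_self he]
      exact inner_re_symm (𝕜 := ℂ) _ _
  have htrace : (opTrace (star U * (CFC.sqrt (maximallyMixed f) *
      CFC.sqrt (maximallyMixed e)))).re = (N : ℝ)⁻¹ * ∑ k, (⟪e k, U (e k)⟫_ℂ).re := by
    rw [sqrt_maximallyMixed he, sqrt_maximallyMixed hf, smul_mul_smul_comm, ← mul_inv,
      Real.mul_self_sqrt (by positivity), mul_smul_comm, re_opTrace_smul, ← mul_assoc,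
      opTrace_mul_frameOperator, Complex.re_sum, Finset.sum_congr rfl fun k _ => hterm k]
  rw [← htrace]
  exact re_opTrace_mul_sqrt_mul_sqrt_le_fidelity ((norm_star U).trans_le hU)
    (maximallyMixed_nonneg f) _

end Fidelity

section Existence

open selfAdjoint Unitary

theorem expUnitary_argSelfAdjoint_of_continuousOn_arg {A : Type*} [CStarAlgebra A] {u : unitary A}
    (hu : ContinuousOn Complex.arg (spectrum ℂ (u : A))) :
    expUnitary (argSelfAdjoint u) = u := by
  have harg : ContinuousOn (fun z => (Complex.arg z : ℂ)) (spectrum ℂ (u : A)) :=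
    Complex.continuous_ofReal.comp_continuousOn hu
  have hexp : ∀ z ∈ spectrum ℂ (u : A), Complex.exp (Complex.I • (Complex.arg z : ℂ)) = z :=
    fun z hz => by
      simpa [spectrum.norm_eq_one_of_unitary u.2 hz, mul_comm]
        using Complex.norm_mul_exp_arg_mul_I z
  refine Subtype.ext ?_
  calc (expUnitary (argSelfAdjoint u) : A)
      = NormedSpace.exp (cfc (fun z => Complex.I • (Complex.arg z : ℂ)) (u : A)) := by
        rw [expUnitary_coe, argSelfAdjoint_coe, cfc_smul _ _ _ harg]
    _ = cfc (fun z => Complex.exp (Complex.I • (Complex.arg z : ℂ))) (u : A) := by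
        rw [← CFC.complex_exp_eq_normedSpace_exp (cfc_predicate _ _),
          ← cfc_comp' _ _ _ (by fun_prop) (by fun_prop)]
    _ = cfc id (u : A) := cfc_congr hexp
    _ = u := cfc_id ℂ (u : A)

variable {H : Type*} [NormedAddCommGroup H] [InnerProductSpace ℂ H] [CompleteSpace H]

theorem isTimeOrderedExp_const (T : ℝ) (L : H →L[ℂ] H) :
    IsTimeOrderedExp T (fun _ => L) fun t => NormedSpace.exp (t • (-Complex.I • L)) := by
  have hderiv : ∀ t : ℝ, HasDerivAt (fun s : ℝ => NormedSpace.exp (s • (-Complex.I • L)))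
      (-Complex.I • (L * NormedSpace.exp (t • (-Complex.I • L)))) t := fun t => by
    rw [← smul_mul_assoc]
    exact hasDerivAt_exp_smul_const' (-Complex.I • L) t
  have hcont : Continuous fun t : ℝ => NormedSpace.exp (t • (-Complex.I • L)) :=
    continuous_iff_continuousAt.2 fun t => (hderiv t).continuousAt
  refine ⟨hcont.continuousOn, fun t _ => ?_⟩
  have hftc := intervalIntegral.integral_eq_sub_of_hasDerivAt (a := 0) (b := t)
    (fun s _ => hderiv s) (Continuous.intervalIntegrable (by fun_prop) 0 t)
  rw [intervalIntegral.integral_smul, zero_smul, NormedSpace.exp_zero, neg_smul] at hftc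
  rw [sub_eq_add_neg, hftc, add_sub_cancel]

theorem norm_mem_chargingTimes_expUnitary [Nontrivial H] (ρ : H →L[ℂ] H)
    (K : selfAdjoint (H →L[ℂ] H)) :
    ‖K‖ ∈ chargingTimes ρ (expUnitary K * ρ * star (expUnitary K : H →L[ℂ] H)) := by
  obtain ⟨L, hL, hL1, hKL⟩ : ∃ L : H →L[ℂ] H, IsSelfAdjoint L ∧ ‖L‖ = 1 ∧ ‖K‖ • -L = K := by
    rcases eq_or_ne K 0 with rfl | hK
    · exact ⟨1, .one _, norm_one, by simp⟩
    · have hK0 : ‖(K : H →L[ℂ] H)‖ ≠ 0 := norm_ne_zero_iff.2 fun h => hK (Subtype.ext h)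
      refine ⟨-(‖K‖⁻¹ • (K : H →L[ℂ] H)), ((IsSelfAdjoint.all ‖K‖⁻¹).smul K.2).neg, ?_, ?_⟩
      · rw [norm_neg, norm_smul, norm_inv, norm_norm, AddSubgroup.coe_norm, inv_mul_cancel₀ hK0]
      · rw [neg_neg, smul_smul, AddSubgroup.coe_norm, mul_inv_cancel₀ hK0, one_smul]
  refine ⟨norm_nonneg K, fun _ => L, _, ⟨aestronglyMeasurable_const, fun _ _ => hL,
    fun _ _ => hL1⟩, isTimeOrderedExp_const ‖K‖ L, ?_⟩
  have hexp : ‖K‖ • (-Complex.I • L) = Complex.I • (K : H →L[ℂ] H) := by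
    rw [← hKL]; module
  rw [hexp, expUnitary_coe]

theorem chargingTimes_unitary_conj_nonempty [FiniteDimensional ℂ H] [Nontrivial H]
    (ρ : H →L[ℂ] H) (W : unitary (H →L[ℂ] H)) :
    (chargingTimes ρ (W * ρ * star (W : H →L[ℂ] H))).Nonempty := by
  have hspec : (spectrum ℂ (W : H →L[ℂ] H)).Finite := by
    rw [← AlgEquiv.spectrum_eq (Module.End.toContinuousLinearMap H).symm]
    exact Module.End.finite_spectrum _
  have hW : expUnitary (argSelfAdjoint W) = W :=
    expUnitary_argSelfAdjoint_of_continuousOn_arg (hspec.continuousOn _)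
  exact ⟨_, hW ▸ norm_mem_chargingTimes_expUnitary ρ (argSelfAdjoint W)⟩

-- As `sInf ∅ = 0`, the charging distance is only bounded below through nonemptiness.
theorem chargingTimes_spectralOperator_nonempty [FiniteDimensional ℂ H] [Nontrivial H]
    {m : ℕ} {n : Fin m → ℕ} (r : Fin m → ℝ)
    (a b : OrthonormalBasis (Σ i : Fin m, Fin (n i)) ℂ H) :
    (chargingTimes (spectralOperator r a) (spectralOperator r b)).Nonempty := by
  let W : unitary (H →L[ℂ] H) :=
    Unitary.linearIsometryEquiv.symm (a.equiv b (Equiv.refl _))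
  have hW : (fun j => (W : H →L[ℂ] H) (a j)) = b := funext fun j => by simp [W]
  have hconj := spectralOperator_apply_comp r (W : H →L[ℂ] H) a
  rw [hW] at hconj
  exact hconj ▸ chargingTimes_unitary_conj_nonempty _ W

end Existence

section SpeedLimit

variable {H : Type*} [NormedAddCommGroup H] [InnerProductSpace ℂ H]

theorem IsDensityOperator.nontrivial {ρ : H →L[ℂ] H} (hρ : IsDensityOperator ρ) :
    Nontrivial H := by
  by_contra hH
  have := not_nontrivial_iff_subsingleton.1 hH
  have htrace := hρ.trace_eq_one
  rw [Subsingleton.elim ρ 0] at htrace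
  simp [opTrace] at htrace

variable [CompleteSpace H]

theorem cos_le_fidelity_maximallyMixed [FiniteDimensional ℂ H] {T : ℝ} (hT : 0 ≤ T)
    (hTπ : T ≤ Real.pi) {V U : ℝ → H →L[ℂ] H} (hU : IsTimeOrderedExp T V U)
    (hV : IsChargingHamiltonian T V) {N : ℕ} (hN : 0 < N) {e f : Fin N → H} (he : Orthonormal ℂ e)
    (hf : Orthonormal ℂ f) (hcomm : frameOperator f * U T = U T * frameOperator e) :
    Real.cos T ≤ fidelity (maximallyMixed e) (maximallyMixed f) := by
  calc Real.cos T = (N : ℝ)⁻¹ * ∑ _k : Fin N, Real.cos T := by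
        have : (N : ℝ) ≠ 0 := by positivity
        simp [this]
    _ ≤ (N : ℝ)⁻¹ * ∑ k, (⟪e k, U T (e k)⟫_ℂ).re := by
        gcongr with k
        exact hU.cos_le_re_inner hT hTπ hV (he.norm_eq_one k)
    _ ≤ fidelity (maximallyMixed e) (maximallyMixed f) :=
        inv_mul_sum_re_inner_le_fidelity he hf (hU.norm_le_one hV ⟨hT, le_rfl⟩) hcomm

theorem buresAngle_maximallyMixed_le_of_mem_chargingTimes [FiniteDimensional ℂ H] {m : ℕ}
    {n : Fin m → ℕ} {r : Fin m → ℝ} (hr : Function.Injective r)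
    (a b : OrthonormalBasis (Σ i : Fin m, Fin (n i)) ℂ H) {T : ℝ}
    (hT : T ∈ chargingTimes (spectralOperator r a) (spectralOperator r b)) {i : Fin m}
    (hi : 0 < n i) :
    buresAngle (maximallyMixed fun k : Fin (n i) => a ⟨i, k⟩)
      (maximallyMixed fun k : Fin (n i) => b ⟨i, k⟩) ≤ T := by
  obtain ⟨hT0, V, U, hV, hU, hσ⟩ := hT
  rcases le_total Real.pi T with hπ | hπ
  · exact (Real.arccos_le_pi _).trans hπ
  have hcomm : spectralOperator r b * U T = U T * spectralOperator r a := by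
    rw [hσ, mul_assoc, hU.star_mul_self hV ⟨hT0, le_rfl⟩, mul_one]
  have hcomm_proj := mul_eq_mul_of_sum_smul_mul_eq
    (completeOrthogonalIdempotents_frameOperator a) (completeOrthogonalIdempotents_frameOperator b)
    (Complex.ofReal_injective.comp hr) hcomm i
  calc _ ≤ Real.arccos (Real.cos T) := Real.arccos_le_arccos <|
        cos_le_fidelity_maximallyMixed hT0 hπ hU hV hi
          (a.orthonormal.comp _ sigma_mk_injective) (b.orthonormal.comp _ sigma_mk_injective)
          hcomm_proj
    _ = T := Real.arccos_cos hT0 hπ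

end SpeedLimit

end QuantumCharging

theorem corollary2_general {H : Type*} [NormedAddCommGroup H] [InnerProductSpace ℂ H]
    [FiniteDimensional ℂ H] [CompleteSpace H] [Nontrivial H]
    {m : ℕ} {n : Fin m → ℕ} (hn : ∀ i, 0 < n i) {r : Fin m → ℝ} (hr : Function.Injective r)
    (a b : OrthonormalBasis (Σ i : Fin m, Fin (n i)) ℂ H) :
    (⨆ i : Fin m, QuantumCharging.buresAngle
        (QuantumCharging.maximallyMixed fun k : Fin (n i) => a ⟨i, k⟩)
        (QuantumCharging.maximallyMixed fun k : Fin (n i) => b ⟨i, k⟩))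
      ≤ QuantumCharging.chargingDistance (QuantumCharging.spectralOperator r a)
        (QuantumCharging.spectralOperator r b) := by
  have : Nonempty (Fin m) := a.toBasis.index_nonempty.map Sigma.fst
  exact ciSup_le fun i =>
    le_csInf (QuantumCharging.chargingTimes_spectralOperator_nonempty r a b) fun _ hT =>
      QuantumCharging.buresAngle_maximallyMixed_le_of_mem_chargingTimes hr a b hT (hn i)

theorem corollary2 {H : Type*} [NormedAddCommGroup H] [InnerProductSpace ℂ H]
    [FiniteDimensional ℂ H] [CompleteSpace H]
    (ρ σ : H →L[ℂ] H)
    (hρ : QuantumCharging.IsDensityOperator ρ) (hσ : QuantumCharging.IsDensityOperator σ)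
    (m : ℕ) (n : Fin m → ℕ) (hn : ∀ i, 0 < n i)
    (r : Fin m → ℝ) (hr : Function.Injective r)
    (a b : OrthonormalBasis (Σ i : Fin m, Fin (n i)) ℂ H)
    (hρa : ρ = QuantumCharging.spectralOperator r a)
    (hσb : σ = QuantumCharging.spectralOperator r b) :
    (⨆ i : Fin m, QuantumCharging.buresAngle
        (QuantumCharging.maximallyMixed fun k : Fin (n i) => a ⟨i, k⟩)
        (QuantumCharging.maximallyMixed fun k : Fin (n i) => b ⟨i, k⟩))
      ≤ QuantumCharging.chargingDistance ρ σ := by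
  subst hρa hσb
  have := hρ.nontrivial
  exact corollary2_general hn hr a b
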